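/- Let $\lambda$ be a cardinal with $2^{<\lambda}=\lambda>\omega$, and let $X$ be a $T_0$ topological space of weight at most $\lambda$. Then there is no continuous $\lambda^+$-measure space $(X,\mathfrak M,\mu)$ on $X$, for any choice of the value structure $(\mathbb S,\boldsymbol\Sigma)$. The notions are as follows. A *positively totally ordered monoid* is a (not necessarily commutative) monoid $\mathbb S=(S,0,+,\le)$ with a total order such that $a\le b$ and $c\le d$ imply $a+c\le b+d$, in which $0$ is the least element and $S\neq\{0\}$. An *infinitary sum* on $\mathbb S$ is a partial function $\boldsymbol\Sigma$ from the sequences of elements of $S$ of arbitrary ordinal length to $S$ such that $\boldsymbol\Sigma(\emptyset)=0$; $\boldsymbol\Sigma(s)=s_0+\dots+s_n$ for every non-empty finite $s=(s_i)_{i\le n}$ in its domain; and for every $s\in\operatorname{dom}(\boldsymbol\Sigma)$ of limit length such that $s\restriction\alpha\in\operatorname{dom}(\boldsymbol\Sigma)$ for cofinally many $\alpha<\operatorname{lh}(s)$, $$\boldsymbol\Sigma(s)=\sup\{\boldsymbol\Sigma(s\restriction\alpha)\mid \alpha<\operatorname{lh}(s),\ s\restriction\alpha\in\operatorname{dom}(\boldsymbol\Sigma)\}.$$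 A *$\lambda^+$-measure space* $(X,\mathfrak M,\mu)$ consists of a topological space $X$, a family $\mathfrak M$ of subsets of $X$ that contains all open sets and is closed under complements and under unions and intersections of at most $\lambda$ sets, and a partial function $\mu:\mathcal P(X)\to S$ with $\mathfrak M\subseteq\operatorname{dom}(\mu)$, where $\mathbb S$ is a positively totally ordered monoid with an infinitary sum $\boldsymbol\Sigma$, such that: (M1) $\mu(\emptyset)=0$; (M2) $\mu(X)>0$; (M3) $\mu(A)\le\mu(B)$ for all $A\subseteq B$ in $\mathfrak M$; (M4) for every family $(A_i)_{i<\gamma}$ of pairwise disjoint sets in $\mathfrak M$ indexed by an ordinal $\gamma<\lambda^+$, the sequence $\langle\mu(A_i)\mid i<\gamma\rangle$ belongs to $\operatorname{dom}(\boldsymbol\Sigma)$ and $\mu(\bigcup_{i<\gamma}A_i)=\boldsymbol\Sigma(\langle\mu(A_i)\mid i<\gamma\rangle)$; (M5) for every $x\in X$ with $\{x\}\in\mathfrak M$ and every open local basis $\{A_i\mid i<\gamma\}$ at $x$ indexed by an ordinal $\gamma<\lambda^+$, $\mu(\{x\})=\inf_{i<\gamma}\mu(A_i)$. It is *continuous*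 if $\{x\}\in\mathfrak M$ and $\mu(\{x\})=0$ for every $x\in X$. -/

import Mathlib

universe u v

/-- The weight of a topological space: the minimal cardinality of a basis of its topology. -/
noncomputable def topWeight (X : Type u) [TopologicalSpace X] : Cardinal.{u} :=
  sInf {c | ∃ B : Set (Set X), TopologicalSpace.IsTopologicalBasis B ∧ Cardinal.mk B = c}

/-- A totally ordered monoid (not assumed commutative) is positively ordered if `0` is its least
element and it is not the trivial monoid. Together with associativity, the neutral element, the
linear order and the two monotonicity classes `AddLeftMono`, `AddRightMono` (equivalently,
`a ≤ b` and `c ≤ d` imply `a + c ≤ b + d`), this is a positively totally ordered monoid. -/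
structure IsPositivelyOrdered (S : Type v) [AddMonoid S] [LinearOrder S] : Prop where
  zero_le : ∀ a : S, 0 ≤ a
  exists_pos : ∃ a : S, 0 < a

/-- A transfinite sequence of elements of `S`: a function from an ordinal `len` (identified with
the set of smaller ordinals) into `S`. -/
structure OrdSeq (S : Type v) where
  len : Ordinal.{u}
  val : Set.Iio len → S

namespace OrdSeq

variable {S : Type v}

/-- The restriction of `s` to an ordinal `α ≤ s.len`. -/
def restrict (s : OrdSeq.{u, v} S) (α : Ordinal.{u}) (h : α ≤ s.len) : OrdSeq.{u, v} S where
  len := α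
  val i := s.val ⟨i.1, lt_of_lt_of_le i.2 h⟩

end OrdSeq

/-- An infinitary sum on a monoid: a partial function from transfinite sequences to `S`
that agrees with `+` on the finite sequences of its domain and is continuous at limit lengths. -/
structure IsInfinitarySum {S : Type v} [AddMonoid S] [LinearOrder S]
    (Sm : OrdSeq.{u, v} S →. S) : Prop where
  /-- The sum of the empty sequence is defined and equal to `0`. -/
  empty : ∀ s : OrdSeq.{u, v} S, s.len = 0 → (0 : S) ∈ Sm s
  /-- On a sequence of finite length `n` in the domain, the value is `s 0 + ⋯ + s (n - 1)`, in this
  order. -/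
  finite : ∀ (n : ℕ) (s : OrdSeq.{u, v} S) (h : s.len = (n : Ordinal.{u})), ∀ v ∈ Sm s,
    v = (List.ofFn fun i : Fin n =>
      s.val ⟨((i : ℕ) : Ordinal.{u}), by rw [Set.mem_Iio, h]; exact_mod_cast i.2⟩).sum
  /-- If `s` has limit length and is in the domain, and cofinally many restrictions of `s` are in
  the domain, then the sum of `s` is the supremum of the sums of these restrictions. -/
  continuous : ∀ s : OrdSeq.{u, v} S, Order.IsSuccLimit s.len →
    (∀ α < s.len, ∃ β, ∃ h : β < s.len, α ≤ β ∧ (Sm (s.restrict β h.le)).Dom) →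
    ∀ v ∈ Sm s, IsLUB {w | ∃ α, ∃ h : α < s.len, w ∈ Sm (s.restrict α h.le)} v

/-- `(X, 𝔐)` is a (non-weak) `lam⁺`-measurable space: `𝔐` is a `lam⁺`-algebra (closed under
complements and under unions and intersections of at most `lam` many sets) that contains all open
subsets of `X`. -/
structure IsMeasurableStructure (lam : Cardinal.{u}) {X : Type u} [TopologicalSpace X]
    (𝔐 : Set (Set X)) : Prop where
  open_mem : ∀ U : Set X, IsOpen U → U ∈ 𝔐
  compl_mem : ∀ A ∈ 𝔐, Aᶜ ∈ 𝔐
  sUnion_mem : ∀ F : Set (Set X), F ⊆ 𝔐 → Cardinal.mk F ≤ lam → ⋃₀ F ∈ 𝔐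
  sInter_mem : ∀ F : Set (Set X), F ⊆ 𝔐 → Cardinal.mk F ≤ lam → ⋂₀ F ∈ 𝔐

/-- The family `A` is an open local basis at `x`. -/
structure IsOpenLocalBasis {X : Type u} [TopologicalSpace X] {ι : Type*} (x : X)
    (A : ι → Set X) : Prop where
  isOpen : ∀ i, IsOpen (A i)
  mem : ∀ i, x ∈ A i
  exists_subset : ∀ U : Set X, IsOpen U → x ∈ U → ∃ i, A i ⊆ U

/-- `μ` is a `lam⁺`-measure on `(X, 𝔐)` with values in `(S, Sm)`. Here `μ` is a partial function
on subsets of `X`, and `a ∈ μ A` says that `μ A` is defined and equal to `a`. -/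
structure IsLamMeasure (lam : Cardinal.{u}) {X : Type u} [TopologicalSpace X]
    (𝔐 : Set (Set X)) {S : Type v} [AddMonoid S] [LinearOrder S]
    (Sm : OrdSeq.{u, v} S →. S) (μ : Set X →. S) : Prop where
  subset_dom : 𝔐 ⊆ μ.Dom
  empty : (0 : S) ∈ μ ∅
  univ_pos : ∃ a ∈ μ Set.univ, 0 < a
  mono : ∀ A ∈ 𝔐, ∀ B ∈ 𝔐, A ⊆ B → ∀ a ∈ μ A, ∀ b ∈ μ B, a ≤ b
  /-- Additivity for disjoint families indexed by an ordinal `γ < lam⁺`: the sequence of the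
  measures is in the domain of the sum, and its sum is the measure of the union. -/
  additive : ∀ γ < (Order.succ lam).ord, ∀ A : Set.Iio γ → Set X, (∀ i, A i ∈ 𝔐) →
    (∀ i j, i ≠ j → Disjoint (A i) (A j)) →
    ∀ s : Set.Iio γ → S, (∀ i, s i ∈ μ (A i)) → ∃ v ∈ Sm ⟨γ, s⟩, v ∈ μ (⋃ i, A i)
  /-- Point-regularity: the measure of a measurable point `x` is the infimum of the measures of
  the members of any open local basis at `x` indexed by an ordinal `γ < lam⁺`. -/
  point_regular : ∀ x : X, {x} ∈ 𝔐 → ∀ γ < (Order.succ lam).ord, ∀ A : Set.Iio γ → Set X,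
    IsOpenLocalBasis x A → ∀ m ∈ μ {x}, IsGLB {a | ∃ i, a ∈ μ (A i)} m

/-- `μ` is continuous: all points are measurable and have measure `0`. -/
def IsContinuousMeasure {X : Type u} (𝔐 : Set (Set X)) {S : Type v} [AddMonoid S]
    (μ : Set X →. S) : Prop :=
  ∀ x : X, {x} ∈ 𝔐 ∧ (0 : S) ∈ μ {x}

/-! Suppose such a measure exists. Two facts drive the argument. If s + s = s, then a union of at
most λ sets of measure at most s has measure at most s (`sUnion_le`); for s = 0 this says that λ
many null sets have a null union. And by point-regularity, for each ε > 0 the space is covered by at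
most λ basic open sets of measure below ε.

Together they forbid infinitely many disjoint sets of measure at least ε inside a set E with μ(E) <
μ(X) (`not_exists_disjoint_ge`): trimmed to measures between ε and ε + ε, the sets have a union of
measure s = sup nε. This s is idempotent, so it bounds μ(X), although s ≤ μ(E).

Some point p has only non-null neighbourhoods. Shrinking them strictly, from a W₀ with μ(W₀) < μ(X),
gives disjoint non-null rings in W₀, whose measures εₙ must be coinitial among the positive values.
Hence for each n, W₀ is up to a null set a countable union of sets of measure below εₙ
(`exists_countable_cover`). Distributing these covers writes W₀, modulo a null set, as a union of
2^ω ≤ λ intersections, each below every εₙ and therefore null. So μ(W₀) = 0, against the choice of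
p. -/

open Cardinal Order

/-! ### Transfinite unions and disjointification -/

/-- The union of the members of a transfinite family with index below `α`. -/
def initialUnion {X : Type u} (G : Ordinal.{u} → Set X) (α : Ordinal.{u}) : Set X :=
  ⋃ i ∈ Set.Iio α, G i

section InitialUnion

variable {X : Type u} (G : Ordinal.{u} → Set X)

theorem mem_initialUnion {α : Ordinal.{u}} {x : X} :
    x ∈ initialUnion G α ↔ ∃ i < α, x ∈ G i := by
  simp [initialUnion]

theorem initialUnion_zero : initialUnion G 0 = ∅ := by
  ext x; simp [mem_initialUnion]

theorem initialUnion_add_one (α : Ordinal.{u}) :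
    initialUnion G (α + 1) = initialUnion G α ∪ G α := by
  ext x
  simp only [mem_initialUnion, Set.mem_union, ← Order.succ_eq_add_one, Order.lt_succ_iff,
    le_iff_lt_or_eq]
  constructor
  · rintro ⟨i, hi | rfl, hx⟩
    · exact Or.inl ⟨i, hi, hx⟩
    · exact Or.inr hx
  · rintro (⟨i, hi, hx⟩ | hx)
    · exact ⟨i, Or.inl hi, hx⟩
    · exact ⟨α, Or.inr rfl, hx⟩

theorem initialUnion_diff_initialUnion (α : Ordinal.{u}) :
    initialUnion (fun i => G i \ initialUnion G i) α = initialUnion G α := by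
  ext x
  simp only [mem_initialUnion, Set.mem_sdiff]
  constructor
  · rintro ⟨i, hi, hx, -⟩
    exact ⟨i, hi, hx⟩
  · rintro ⟨i, hi, hx⟩
    -- Descend to the least index whose set contains `x`.
    induction i using WellFoundedLT.induction with
    | _ i ih =>
      by_cases h : ∃ j < i, x ∈ G j
      · obtain ⟨j, hj, hxj⟩ := h
        exact ih j hj (hj.trans hi) hxj
      · exact ⟨i, hi, hx, h⟩

theorem disjoint_diff_initialUnion {i j : Ordinal.{u}} (hij : i ≠ j) :
    Disjoint (G i \ initialUnion G i) (G j \ initialUnion G j) := by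
  rw [Set.disjoint_left]
  rintro x ⟨hi, hi'⟩ ⟨hj, hj'⟩
  rw [mem_initialUnion] at hi' hj'
  rcases lt_or_gt_of_ne hij with h | h
  · exact hj' ⟨i, h, hi⟩
  · exact hi' ⟨j, h, hj⟩

theorem initialUnion_inter (B : Set X) (α : Ordinal.{u}) :
    initialUnion (fun i => G i ∩ B) α = initialUnion G α ∩ B := by
  ext x
  simp only [mem_initialUnion, Set.mem_inter_iff]
  exact ⟨fun ⟨i, hi, h, hB⟩ => ⟨⟨i, hi, h⟩, hB⟩, fun ⟨⟨i, hi, h⟩, hB⟩ => ⟨i, hi, h, hB⟩⟩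

/-- The transfinite family that agrees with `A` on the natural numbers and is empty elsewhere. -/
def extendNat (A : ℕ → Set X) (o : Ordinal.{u}) : Set X :=
  ⋃ (n : ℕ) (_ : (n : Ordinal.{u}) = o), A n

theorem initialUnion_extendNat (A : ℕ → Set X) (n : ℕ) :
    initialUnion (extendNat A) (n : Ordinal.{u}) = ⋃ k ∈ Set.Iio n, A k := by
  ext x
  simp only [mem_initialUnion, extendNat, Set.mem_iUnion, Set.mem_Iio]
  constructor
  · rintro ⟨_, hi, k, rfl, hx⟩
    exact ⟨k, by exact_mod_cast hi, hx⟩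
  · rintro ⟨k, hk, hx⟩
    exact ⟨k, by exact_mod_cast hk, k, rfl, hx⟩

theorem initialUnion_extendNat_omega0 (A : ℕ → Set X) :
    initialUnion (extendNat A) Ordinal.omega0.{u} = ⋃ k, A k := by
  ext x
  simp only [mem_initialUnion, extendNat, Set.mem_iUnion]
  constructor
  · rintro ⟨_, hi, k, rfl, hx⟩
    exact ⟨k, hx⟩
  · rintro ⟨k, hx⟩
    exact ⟨k, Ordinal.natCast_lt_omega0 k, k, rfl, hx⟩

theorem extendNat_mem {𝔐 : Set (Set X)} (h0 : ∅ ∈ 𝔐) {A : ℕ → Set X} (hA : ∀ n, A n ∈ 𝔐)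
    (o : Ordinal.{u}) : extendNat A o ∈ 𝔐 := by
  by_cases h : ∃ n : ℕ, (n : Ordinal.{u}) = o
  · obtain ⟨n, rfl⟩ := h
    simpa [extendNat] using hA n
  · have : extendNat A o = ∅ := by
      simp only [extendNat, Set.iUnion_eq_empty]
      exact fun n hn => absurd ⟨n, hn⟩ h
    rwa [this]

end InitialUnion

/-- A set of cardinality at most `lam` is enumerated by an ordinal below `lam⁺`. -/
theorem exists_range_eq_of_mk_le {α : Type u} {lam : Cardinal.{u}} (F : Set α)
    (hF : #F ≤ lam) :
    ∃ γ < (succ lam).ord, ∃ e : Set.Iio γ → α, Set.range e = F := by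
  refine ⟨(#F).ord, by rw [lt_ord, card_ord]; exact Order.lt_succ_iff.2 hF, ?_⟩
  have h : #(#F).ord.ToType = #F := mk_ord_toType _
  obtain ⟨f⟩ := Cardinal.eq.1 h
  refine ⟨fun i => (f (Ordinal.ToType.mk i) : α), ?_⟩
  ext x
  constructor
  · rintro ⟨i, rfl⟩
    exact (f _).2
  · intro hx
    exact ⟨Ordinal.ToType.mk.symm (f.symm ⟨x, hx⟩), by simp⟩

theorem exists_initialUnion_eq_sUnion {X : Type u} {lam : Cardinal.{u}} (F : Set (Set X))
    (hF : #F ≤ lam) : ∃ γ < (succ lam).ord, ∃ G : Ordinal.{u} → Set X,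
      (∀ i, G i ∈ F ∨ G i = ∅) ∧ initialUnion G γ = ⋃₀ F := by
  obtain ⟨γ, hγ, e, he⟩ := exists_range_eq_of_mk_le F hF
  classical
  refine ⟨γ, hγ, fun i => if h : i < γ then e ⟨i, h⟩ else ∅, fun i => ?_, ?_⟩
  · by_cases h : i < γ
    · left
      simp only [h, dite_true]
      exact he ▸ Set.mem_range_self _
    · right
      simp [h]
  · ext x
    rw [mem_initialUnion, ← he]
    simp only [Set.sUnion_range, Set.mem_iUnion, Subtype.exists, Set.mem_Iio]
    constructor
    · rintro ⟨i, hi, hx⟩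
      exact ⟨i, hi, by simpa [hi] using hx⟩
    · rintro ⟨i, hi, hx⟩
      exact ⟨i, hi, by simpa [hi] using hx⟩

/-! ### Closure properties of the algebra -/

namespace IsMeasurableStructure

variable {lam : Cardinal.{u}} {X : Type u} [TopologicalSpace X] {𝔐 : Set (Set X)}

theorem empty_mem (h : IsMeasurableStructure lam 𝔐) : ∅ ∈ 𝔐 := h.open_mem _ isOpen_empty

theorem univ_mem (h : IsMeasurableStructure lam 𝔐) : Set.univ ∈ 𝔐 := h.open_mem _ isOpen_univ

theorem iUnion_mem (h : IsMeasurableStructure lam 𝔐) {ι : Type*} (A : ι → Set X)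
    (hA : ∀ i, A i ∈ 𝔐) (hι : Cardinal.lift.{u} #ι ≤ Cardinal.lift lam) : ⋃ i, A i ∈ 𝔐 := by
  rw [← Set.sUnion_range]
  refine h.sUnion_mem _ (Set.range_subset_iff.2 hA) ?_
  exact Cardinal.lift_le.1 (mk_range_le_lift.trans hι)

theorem iInter_mem (h : IsMeasurableStructure lam 𝔐) {ι : Type*} (A : ι → Set X)
    (hA : ∀ i, A i ∈ 𝔐) (hι : Cardinal.lift.{u} #ι ≤ Cardinal.lift lam) : ⋂ i, A i ∈ 𝔐 := by
  rw [← Set.sInter_range]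
  refine h.sInter_mem _ (Set.range_subset_iff.2 hA) ?_
  exact Cardinal.lift_le.1 (mk_range_le_lift.trans hι)

theorem iUnion_nat_mem (h : IsMeasurableStructure lam 𝔐) (hlam : ℵ₀ ≤ lam) (A : ℕ → Set X)
    (hA : ∀ i, A i ∈ 𝔐) : ⋃ i, A i ∈ 𝔐 :=
  h.iUnion_mem A hA (by simpa using hlam)

theorem iInter_nat_mem (h : IsMeasurableStructure lam 𝔐) (hlam : ℵ₀ ≤ lam) (A : ℕ → Set X)
    (hA : ∀ i, A i ∈ 𝔐) : ⋂ i, A i ∈ 𝔐 :=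
  h.iInter_mem A hA (by simpa using hlam)

theorem union_mem (h : IsMeasurableStructure lam 𝔐) (hlam : ℵ₀ ≤ lam) {A B : Set X}
    (hA : A ∈ 𝔐) (hB : B ∈ 𝔐) : A ∪ B ∈ 𝔐 := by
  rw [Set.union_eq_iUnion]
  refine h.iUnion_mem _ (by rintro (_ | _) <;> assumption) ?_
  simpa using (natCast_le_aleph0 (n := 2)).trans hlam

theorem inter_mem (h : IsMeasurableStructure lam 𝔐) (hlam : ℵ₀ ≤ lam) {A B : Set X}
    (hA : A ∈ 𝔐) (hB : B ∈ 𝔐) : A ∩ B ∈ 𝔐 := by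
  rw [← compl_compl (A ∩ B), Set.compl_inter]
  exact h.compl_mem _ (h.union_mem hlam (h.compl_mem _ hA) (h.compl_mem _ hB))

theorem diff_mem (h : IsMeasurableStructure lam 𝔐) (hlam : ℵ₀ ≤ lam) {A B : Set X}
    (hA : A ∈ 𝔐) (hB : B ∈ 𝔐) : A \ B ∈ 𝔐 :=
  h.inter_mem hlam hA (h.compl_mem _ hB)

theorem initialUnion_mem (h : IsMeasurableStructure lam 𝔐) {G : Ordinal.{u} → Set X}
    (hG : ∀ i, G i ∈ 𝔐) {γ : Ordinal.{u}} (hγ : γ < (succ lam).ord) : initialUnion G γ ∈ 𝔐 := by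
  rw [initialUnion, Set.biUnion_eq_iUnion]
  refine h.iUnion_mem (ι := Set.Iio γ) _ (fun i => hG i) ?_
  rw [lt_ord, Order.lt_succ_iff] at hγ
  rw [mk_Iio_ordinal, Cardinal.lift_lift]
  exact Cardinal.lift_le.2 hγ

end IsMeasurableStructure

/-! ### From infinitary sums to continuity along chains -/

/-- A total set function that is monotone, finitely additive and continuous along the initial
unions of transfinite families of length less than `lam⁺`. -/
structure IsChainMeasure (lam : Cardinal.{u}) {X : Type u} (𝔐 : Set (Set X))
    {S : Type v} [AddMonoid S] [LinearOrder S] (m : Set X → S) : Prop where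
  zero_le : ∀ a : S, 0 ≤ a
  empty : m ∅ = 0
  mono : ∀ A ∈ 𝔐, ∀ B ∈ 𝔐, A ⊆ B → m A ≤ m B
  union : ∀ A ∈ 𝔐, ∀ B ∈ 𝔐, Disjoint A B → m (A ∪ B) = m A + m B
  isLUB : ∀ G : Ordinal.{u} → Set X, (∀ i, G i ∈ 𝔐) → ∀ γ < (succ lam).ord, IsSuccLimit γ →
    IsLUB {w | ∃ α < γ, w = m (initialUnion G α)} (m (initialUnion G γ))

namespace IsLamMeasure

variable {lam : Cardinal.{u}} {X : Type u} [TopologicalSpace X] {𝔐 : Set (Set X)}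
  {S : Type v} [AddMonoid S] [LinearOrder S] {Sm : OrdSeq.{u, v} S →. S} {μ : Set X →. S}
  {m : Set X → S}

theorem exists_mem_sum (hμ : IsLamMeasure lam 𝔐 Sm μ) (hm : ∀ A ∈ 𝔐, m A ∈ μ A)
    {D : Ordinal.{u} → Set X} (hD : ∀ i, D i ∈ 𝔐) {γ : Ordinal.{u}} (hγ : γ < (succ lam).ord)
    (hdisj : ∀ i < γ, ∀ j < γ, i ≠ j → Disjoint (D i) (D j)) (hU : initialUnion D γ ∈ 𝔐) :
    m (initialUnion D γ) ∈ Sm ⟨γ, fun i => m (D i)⟩ := by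
  obtain ⟨v, hv, hv'⟩ := hμ.additive γ hγ (fun i => D i) (fun i => hD i)
    (fun i j hij => hdisj i i.2 j j.2 (fun h => hij (Subtype.ext h))) (fun i => m (D i))
    (fun i => hm _ (hD i))
  have : (⋃ i : Set.Iio γ, D i) = initialUnion D γ := by
    rw [initialUnion, Set.biUnion_eq_iUnion]
  rw [this] at hv'
  rwa [Part.mem_unique (hm _ hU) hv']

/-- After this the infinitary sum is no longer needed: its finite clause gives binary additivity,
and its limit clause, applied to the disjointified family, gives continuity. -/
theorem isChainMeasure (hlam : ℵ₀ ≤ lam) (h𝔐 : IsMeasurableStructure lam 𝔐)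
    (hμ : IsLamMeasure lam 𝔐 Sm μ) (hS : IsPositivelyOrdered S) (hSm : IsInfinitarySum Sm)
    (hm : ∀ A ∈ 𝔐, m A ∈ μ A) : IsChainMeasure lam 𝔐 m where
  zero_le := hS.zero_le
  empty := Part.mem_unique (hm _ h𝔐.empty_mem) hμ.empty
  mono A hA B hB h := hμ.mono A hA B hB h _ (hm A hA) _ (hm B hB)
  union A hA B hB hAB := by
    have h2 : ((2 : ℕ) : Ordinal.{u}) < (succ lam).ord := by
      rw [lt_ord, Order.lt_succ_iff, Ordinal.card_nat]
      exact natCast_le_aleph0.trans hlam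
    let E : ℕ → Set X := fun n => if n = 0 then A else if n = 1 then B else ∅
    have hE : ∀ n, E n ∈ 𝔐 := by
      intro n
      dsimp only [E]
      split_ifs
      exacts [hA, hB, h𝔐.empty_mem]
    have hval : ∀ n : ℕ, extendNat E (n : Ordinal.{u}) = E n := fun n => by simp [extendNat]
    have hU : initialUnion (extendNat E) ((2 : ℕ) : Ordinal.{u}) = A ∪ B := by
      rw [initialUnion_extendNat]
      ext x
      simp only [Set.mem_iUnion, Set.mem_Iio, Set.mem_union, exists_prop]
      constructor
      · rintro ⟨k, hk, hx⟩
        interval_cases k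
        · exact Or.inl hx
        · exact Or.inr hx
      · rintro (hx | hx)
        · exact ⟨0, by norm_num, hx⟩
        · exact ⟨1, by norm_num, hx⟩
    have key := hμ.exists_mem_sum hm (extendNat_mem h𝔐.empty_mem hE) h2 ?_
      (hU ▸ h𝔐.union_mem hlam hA hB)
    · have := hSm.finite 2 _ rfl _ key
      rw [hU] at this
      rw [this]
      have e0 := hval 0
      have e1 := hval 1
      simp only [Nat.cast_zero, Nat.cast_one] at e0 e1
      simp [List.ofFn_succ, e0, e1, E]
    · intro i hi j hj hij
      obtain ⟨a, rfl⟩ := Ordinal.lt_omega0.1 (hi.trans (Ordinal.natCast_lt_omega0 2))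
      obtain ⟨b, rfl⟩ := Ordinal.lt_omega0.1 (hj.trans (Ordinal.natCast_lt_omega0 2))
      rw [hval, hval]
      have ha : a < 2 := by exact_mod_cast hi
      have hb : b < 2 := by exact_mod_cast hj
      obtain rfl | rfl : a = 0 ∨ a = 1 := by lia
      all_goals obtain rfl | rfl : b = 0 ∨ b = 1 := by lia
      · exact absurd rfl hij
      · exact hAB
      · exact hAB.symm
      · exact absurd rfl hij
  isLUB G hG γ hγ hlim := by
    -- From `γ` on the value is `∅`, because `initialUnion G i` need not be measurable for large
    -- `i`.
    set D : Ordinal.{u} → Set X := fun i => if i < γ then G i \ initialUnion G i else ∅ with hDdef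
    have hD : ∀ i, D i ∈ 𝔐 := by
      intro i
      by_cases hi : i < γ
      · simp only [hDdef, hi, if_true]
        exact h𝔐.diff_mem hlam (hG i) (h𝔐.initialUnion_mem hG (hi.trans hγ))
      · simp only [hDdef, hi, if_false]
        exact h𝔐.empty_mem
    have hU : ∀ α ≤ γ, initialUnion D α = initialUnion G α := by
      intro α hα
      rw [← initialUnion_diff_initialUnion G α]
      ext x
      simp only [mem_initialUnion]
      refine exists_congr fun i => and_congr_right fun hi => ?_
      simp only [hDdef, hi.trans_le hα, if_true]
    have hmem : ∀ α ≤ γ, m (initialUnion G α) ∈ Sm ⟨α, fun i => m (D i)⟩ := by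
      intro α hα
      rw [← hU α hα]
      refine hμ.exists_mem_sum hm hD (hα.trans_lt hγ) (fun i hi j hj hij => ?_)
        (h𝔐.initialUnion_mem hD (hα.trans_lt hγ))
      simp only [hDdef, hi.trans_le hα, hj.trans_le hα, if_true]
      exact disjoint_diff_initialUnion G hij
    have key := hSm.continuous ⟨γ, fun i => m (D i)⟩ hlim
      (fun α hα => ⟨α, hα, le_rfl, Part.dom_iff_mem.2 ⟨_, hmem α hα.le⟩⟩) _ (hmem γ le_rfl)
    convert key using 1
    ext w
    constructor
    · rintro ⟨α, hα, rfl⟩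
      exact ⟨α, hα, hmem α hα.le⟩
    · rintro ⟨α, hα, hw⟩
      exact ⟨α, hα, Part.mem_unique hw (hmem α hα.le)⟩

end IsLamMeasure

/-! ### Subadditivity and trimming -/

namespace IsChainMeasure

variable {lam : Cardinal.{u}} {X : Type u} [TopologicalSpace X] {𝔐 : Set (Set X)}
  {S : Type v} [AddMonoid S] [LinearOrder S] {m : Set X → S}

section Subadditive

variable [AddLeftMono S] [AddRightMono S]

theorem union_le (hm : IsChainMeasure lam 𝔐 m) (h𝔐 : IsMeasurableStructure lam 𝔐)
    (hlam : ℵ₀ ≤ lam) {A B : Set X} (hA : A ∈ 𝔐) (hB : B ∈ 𝔐) : m (A ∪ B) ≤ m A + m B := by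
  have hBA := h𝔐.diff_mem hlam hB hA
  rw [← Set.union_sdiff_self, hm.union A hA _ hBA Set.disjoint_sdiff_right]
  exact add_le_add le_rfl (hm.mono _ hBA _ hB Set.sdiff_subset)

/-- Idempotence of `s` absorbs each successor step, and continuity handles the limits. -/
theorem initialUnion_le (hm : IsChainMeasure lam 𝔐 m) (h𝔐 : IsMeasurableStructure lam 𝔐)
    (hlam : ℵ₀ ≤ lam) {s : S} (hs : s + s ≤ s) {G : Ordinal.{u} → Set X} (hG : ∀ i, G i ∈ 𝔐)
    (hGs : ∀ i, m (G i) ≤ s) {γ : Ordinal.{u}} (hγ : γ < (succ lam).ord) :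
    m (initialUnion G γ) ≤ s := by
  induction γ using Ordinal.limitRecOn with
  | zero => rw [initialUnion_zero, hm.empty]; exact hm.zero_le s
  | add_one α ih =>
    have hα : α < (succ lam).ord := (Order.lt_add_one_iff.2 le_rfl).trans hγ
    rw [initialUnion_add_one]
    exact (hm.union_le h𝔐 hlam (h𝔐.initialUnion_mem hG hα) (hG α)).trans
      ((add_le_add (ih hα) (hGs α)).trans hs)
  | limit γ hlim ih =>
    refine (hm.isLUB G hG γ hγ hlim).2 ?_
    rintro _ ⟨α, hα, rfl⟩
    exact ih α hα (hα.trans hγ)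

/-- A union of at most `lam` many sets whose measures are bounded by an idempotent value `s` has
measure at most `s`. -/
theorem sUnion_le (hm : IsChainMeasure lam 𝔐 m) (h𝔐 : IsMeasurableStructure lam 𝔐)
    (hlam : ℵ₀ ≤ lam) {s : S} (hs : s + s ≤ s) {F : Set (Set X)} (hF : #F ≤ lam)
    (hF𝔐 : F ⊆ 𝔐) (hFs : ∀ B ∈ F, m B ≤ s) : m (⋃₀ F) ≤ s := by
  obtain ⟨γ, hγ, G, hG, hU⟩ := exists_initialUnion_eq_sUnion F hF
  rw [← hU]
  refine hm.initialUnion_le h𝔐 hlam hs (fun i => ?_) (fun i => ?_) hγ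
  · rcases hG i with h | h
    · exact hF𝔐 h
    · exact h ▸ h𝔐.empty_mem
  · rcases hG i with h | h
    · exact hFs _ h
    · rw [h, hm.empty]; exact hm.zero_le s

theorem iUnion_le (hm : IsChainMeasure lam 𝔐 m) (h𝔐 : IsMeasurableStructure lam 𝔐)
    (hlam : ℵ₀ ≤ lam) {s : S} (hs : s + s ≤ s) {ι : Type*} (A : ι → Set X)
    (hι : Cardinal.lift.{u} #ι ≤ Cardinal.lift lam)
    (hA : ∀ i, A i ∈ 𝔐) (hAs : ∀ i, m (A i) ≤ s) : m (⋃ i, A i) ≤ s := by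
  rw [← Set.sUnion_range]
  exact hm.sUnion_le h𝔐 hlam hs (Cardinal.lift_le.1 (mk_range_le_lift.trans hι))
    (Set.range_subset_iff.2 hA) (Set.forall_mem_range.2 hAs)

/-- If a set of measure at least `ε` is covered by at most `lam` many sets of measure at most `ε`,
then it has a subset whose measure lies between `ε` and `ε + ε`. -/
theorem exists_subset_le_add_self (hm : IsChainMeasure lam 𝔐 m)
    (h𝔐 : IsMeasurableStructure lam 𝔐) (hlam : ℵ₀ ≤ lam) {ε : S} (hε : 0 < ε)
    {F : Set (Set X)} (hF : #F ≤ lam) (hF𝔐 : F ⊆ 𝔐) (hFε : ∀ B ∈ F, m B ≤ ε) {B : Set X}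
    (hB : B ∈ 𝔐) (hBF : B ⊆ ⋃₀ F) (hεB : ε ≤ m B) :
    ∃ C ∈ 𝔐, C ⊆ B ∧ ε ≤ m C ∧ m C ≤ ε + ε := by
  obtain ⟨γ, hγ, G, hG, hU⟩ := exists_initialUnion_eq_sUnion F hF
  have hG𝔐 : ∀ i, G i ∈ 𝔐 := fun i => by
    rcases hG i with h | h
    · exact hF𝔐 h
    · exact h ▸ h𝔐.empty_mem
  have hGε : ∀ i, m (G i) ≤ ε := fun i => by
    rcases hG i with h | h
    · exact hFε _ h
    · rw [h, hm.empty]; exact hε.le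
  set K : Ordinal.{u} → Set X := fun i => G i ∩ B with hK
  have hK𝔐 : ∀ i, K i ∈ 𝔐 := fun i => h𝔐.inter_mem hlam (hG𝔐 i) hB
  have hKε : ∀ i, m (K i) ≤ ε := fun i =>
    (hm.mono _ (hK𝔐 i) _ (hG𝔐 i) Set.inter_subset_left).trans (hGε i)
  have hKB : ∀ α, initialUnion K α ⊆ B := fun α => by
    rw [hK, initialUnion_inter]; exact Set.inter_subset_right
  have hKγ : initialUnion K γ = B := by
    rw [hK, initialUnion_inter, hU]; exact Set.inter_eq_right.2 hBF
  -- The witness is the initial union at the first stage reaching `ε`. Earlier stages lie below `ε`,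
  -- so a successor step overshoots by at most one more `ε`, and a limit stage not at all.
  let P : Set Ordinal.{u} := {α | ε ≤ m (initialUnion K α)}
  have hP : γ ∈ P := by simpa [P, hKγ] using hεB
  have hlt : ∀ α, (∀ β < α, β ∉ P) → α < (succ lam).ord → m (initialUnion K α) ≤ ε + ε := by
    intro α hα hαl
    rcases Ordinal.zero_or_succ_or_isSuccLimit α with rfl | ⟨β, rfl⟩ | hlim
    · rw [initialUnion_zero, hm.empty]; exact hm.zero_le _
    · have hβ := Order.lt_succ β
      rw [Order.succ_eq_add_one, initialUnion_add_one]
      refine (hm.union_le h𝔐 hlam (h𝔐.initialUnion_mem hK𝔐 (hβ.trans hαl)) (hK𝔐 β)).trans ?_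
      exact add_le_add (not_le.1 (hα β hβ)).le (hKε β)
    · refine ((hm.isLUB K hK𝔐 α hαl hlim).2 ?_).trans (le_add_of_nonneg_left (hm.zero_le ε))
      rintro _ ⟨β, hβ, rfl⟩
      exact (not_le.1 (hα β hβ)).le
  have hmin := WellFounded.min_mem (wellFounded_lt (α := Ordinal.{u})) P ⟨γ, hP⟩
  set α := WellFounded.min (wellFounded_lt (α := Ordinal.{u})) P ⟨γ, hP⟩ with hαdef
  have hαγ : α ≤ γ := not_lt.1 (WellFounded.not_lt_min _ _ hP)
  have hαl := hαγ.trans_lt hγ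
  exact ⟨_, h𝔐.initialUnion_mem hK𝔐 hαl, hKB α, hmin,
    hlt α (fun β hβ hβP => WellFounded.not_lt_min _ _ hβP hβ) hαl⟩

end Subadditive

/-! ### Countable disjoint families and idempotent values -/

theorem isLUB_nat (hm : IsChainMeasure lam 𝔐 m) (h𝔐 : IsMeasurableStructure lam 𝔐)
    (hlam : ℵ₀ ≤ lam) {A : ℕ → Set X} (hA : ∀ n, A n ∈ 𝔐) :
    IsLUB (Set.range fun n : ℕ => m (⋃ k ∈ Set.Iio n, A k)) (m (⋃ k, A k)) := by
  have hω : Ordinal.omega0.{u} < (succ lam).ord := by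
    rw [lt_ord, Order.lt_succ_iff, Ordinal.card_omega0]
    exact hlam
  have := hm.isLUB _ (extendNat_mem h𝔐.empty_mem hA) _ hω Ordinal.isSuccLimit_omega0
  rw [initialUnion_extendNat_omega0] at this
  convert this using 1
  ext w
  constructor
  · rintro ⟨n, rfl⟩
    exact ⟨n, Ordinal.natCast_lt_omega0 n, by rw [initialUnion_extendNat]⟩
  · rintro ⟨α, hα, rfl⟩
    obtain ⟨n, rfl⟩ := Ordinal.lt_omega0.1 hα
    exact ⟨n, by simp only [initialUnion_extendNat]⟩

theorem biUnion_Iio_mem (h𝔐 : IsMeasurableStructure lam 𝔐)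
    (hlam : ℵ₀ ≤ lam) {A : ℕ → Set X} (hA : ∀ n, A n ∈ 𝔐) (n : ℕ) :
    (⋃ k ∈ Set.Iio n, A k) ∈ 𝔐 := by
  induction n with
  | zero => simpa using h𝔐.empty_mem
  | succ n ih =>
    have : (⋃ k ∈ Set.Iio (n + 1), A k) = (⋃ k ∈ Set.Iio n, A k) ∪ A n := by
      simp only [Set.mem_Iio]
      exact Set.biUnion_lt_succ A n
    rw [this]
    exact h𝔐.union_mem hlam ih (hA n)

theorem biUnion_Iio_add_one (hm : IsChainMeasure lam 𝔐 m) (h𝔐 : IsMeasurableStructure lam 𝔐)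
    (hlam : ℵ₀ ≤ lam) {A : ℕ → Set X} (hA : ∀ n, A n ∈ 𝔐)
    (hdisj : Pairwise fun i j => Disjoint (A i) (A j)) (n : ℕ) :
    m (⋃ k ∈ Set.Iio (n + 1), A k) = m (⋃ k ∈ Set.Iio n, A k) + m (A n) := by
  have : (⋃ k ∈ Set.Iio (n + 1), A k) = (⋃ k ∈ Set.Iio n, A k) ∪ A n := by
    simp only [Set.mem_Iio]
    exact Set.biUnion_lt_succ A n
  rw [this, hm.union _ (biUnion_Iio_mem h𝔐 hlam hA n) _ (hA n)]
  exact Set.disjoint_iUnion₂_left.2 fun k hk => hdisj (ne_of_lt hk)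

variable [AddLeftMono S] [AddRightMono S]

/-- If the measures of disjoint sets all lie between `ε` and `ε + ε`, then the measure of their
union is the supremum of the multiples of `ε`. -/
theorem isLUB_nsmul (hm : IsChainMeasure lam 𝔐 m) (h𝔐 : IsMeasurableStructure lam 𝔐)
    (hlam : ℵ₀ ≤ lam) {A : ℕ → Set X} (hA : ∀ n, A n ∈ 𝔐)
    (hdisj : Pairwise fun i j => Disjoint (A i) (A j)) {ε : S} (h1 : ∀ n, ε ≤ m (A n))
    (h2 : ∀ n, m (A n) ≤ ε + ε) : IsLUB (Set.range fun n : ℕ => n • ε) (m (⋃ k, A k)) := by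
  have hl : ∀ n : ℕ, n • ε ≤ m (⋃ k ∈ Set.Iio n, A k) := by
    intro n
    induction n with
    | zero => rw [zero_nsmul]; exact hm.zero_le _
    | succ n ih =>
      rw [succ_nsmul, hm.biUnion_Iio_add_one h𝔐 hlam hA hdisj]
      exact add_le_add ih (h1 n)
  have hr : ∀ n : ℕ, m (⋃ k ∈ Set.Iio n, A k) ≤ (n * 2) • ε := by
    intro n
    induction n with
    | zero => simp [hm.empty]
    | succ n ih =>
      rw [hm.biUnion_Iio_add_one h𝔐 hlam hA hdisj, add_mul, one_mul, add_nsmul, two_nsmul]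
      exact add_le_add ih (h2 n)
  have hlub := hm.isLUB_nat h𝔐 hlam hA
  constructor
  · rintro _ ⟨n, rfl⟩
    exact (hl n).trans (hlub.1 ⟨n, rfl⟩)
  · intro b hb
    refine hlub.2 ?_
    rintro _ ⟨n, rfl⟩
    exact (hr n).trans (hb ⟨n * 2, rfl⟩)

/-- The supremum of the multiples of `ε` does not depend on the family, so the even-indexed and
odd-indexed halves each have the measure of the whole. -/
theorem add_self_of_isLUB (hm : IsChainMeasure lam 𝔐 m) (h𝔐 : IsMeasurableStructure lam 𝔐)
    (hlam : ℵ₀ ≤ lam) {A : ℕ → Set X} (hA : ∀ n, A n ∈ 𝔐)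
    (hdisj : Pairwise fun i j => Disjoint (A i) (A j)) {ε : S} (h1 : ∀ n, ε ≤ m (A n))
    (h2 : ∀ n, m (A n) ≤ ε + ε) : m (⋃ k, A k) + m (⋃ k, A k) = m (⋃ k, A k) := by
  have h := hm.isLUB_nsmul h𝔐 hlam hA hdisj h1 h2
  have he := hm.isLUB_nsmul h𝔐 hlam (A := fun n => A (2 * n)) (fun n => hA _)
    (fun i j hij => hdisj (by lia)) (fun n => h1 _) (fun n => h2 _)
  have ho := hm.isLUB_nsmul h𝔐 hlam (A := fun n => A (2 * n + 1)) (fun n => hA _)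
    (fun i j hij => hdisj (by lia)) (fun n => h1 _) (fun n => h2 _)
  have hU : (⋃ k, A k) = (⋃ k, A (2 * k)) ∪ ⋃ k, A (2 * k + 1) := by
    ext x
    simp only [Set.mem_union, Set.mem_iUnion]
    constructor
    · rintro ⟨k, hk⟩
      obtain ⟨j, rfl | rfl⟩ := Nat.even_or_odd' k
      · exact Or.inl ⟨j, hk⟩
      · exact Or.inr ⟨j, hk⟩
    · rintro (⟨k, hk⟩ | ⟨k, hk⟩)
      exacts [⟨_, hk⟩, ⟨_, hk⟩]
  have hadd : m (⋃ k, A k) = m (⋃ k, A (2 * k)) + m (⋃ k, A (2 * k + 1)) := by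
    rw [hU]
    refine hm.union _ (h𝔐.iUnion_nat_mem hlam _ fun n => hA _) _
      (h𝔐.iUnion_nat_mem hlam _ fun n => hA _) ?_
    exact Set.disjoint_iUnion_left.2 fun i => Set.disjoint_iUnion_right.2 fun j =>
      hdisj (by lia)
  rw [he.unique h, ho.unique h] at hadd
  exact hadd.symm

/-! ### Sets of less than full measure -/

/-- If the space is covered, for each positive `ε`, by at most `lam` many sets of measure at most
`ε`, then a set of measure less than that of the whole space contains no infinite disjoint family
of sets whose measures are bounded away from `0`. -/
theorem not_exists_disjoint_ge (hm : IsChainMeasure lam 𝔐 m)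
    (h𝔐 : IsMeasurableStructure lam 𝔐) (hlam : ℵ₀ ≤ lam)
    (hcov : ∀ ε : S, 0 < ε → ∃ F : Set (Set X), #F ≤ lam ∧ F ⊆ 𝔐 ∧ (∀ B ∈ F, m B < ε) ∧
      ⋃₀ F = Set.univ)
    {A : ℕ → Set X} (hA : ∀ n, A n ∈ 𝔐) (hdisj : Pairwise fun i j => Disjoint (A i) (A j))
    {E : Set X} (hE : E ∈ 𝔐) (hAE : ∀ n, A n ⊆ E) (hEX : m E < m Set.univ)
    {ε : S} (hε : 0 < ε) : ∃ n, m (A n) < ε := by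
  by_contra! hge
  obtain ⟨F, hF, hF𝔐, hFε, hFU⟩ := hcov ε hε
  choose C hC𝔐 hCA hC1 hC2 using fun n => hm.exists_subset_le_add_self h𝔐 hlam hε hF hF𝔐
    (fun B hB => (hFε B hB).le) (hA n) (hFU ▸ Set.subset_univ _) (hge n)
  have hCd : Pairwise fun i j => Disjoint (C i) (C j) := fun i j hij =>
    (hdisj hij).mono (hCA i) (hCA j)
  have hidem := hm.add_self_of_isLUB h𝔐 hlam hC𝔐 hCd hC1 hC2
  have hU𝔐 := h𝔐.iUnion_nat_mem hlam C hC𝔐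
  have hpos : ε ≤ m (⋃ k, C k) :=
    (hC1 0).trans (hm.mono _ (hC𝔐 0) _ hU𝔐 (Set.subset_iUnion C 0))
  have hsmall : m (⋃ k, C k) ≤ m E :=
    hm.mono _ hU𝔐 _ hE (Set.iUnion_subset fun n => (hCA n).trans (hAE n))
  -- The idempotent value m(⋃ C) dominates `ε`, hence every member of the cover, hence the whole
  -- space.
  have hle := hm.sUnion_le h𝔐 hlam hidem.le hF hF𝔐 fun B hB => (hFε B hB).le.trans hpos
  rw [hFU] at hle
  exact absurd (hle.trans hsmall) (not_le.2 hEX)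

/-- Under the same assumptions, if moreover the positive values have a countable coinitial family,
a set of measure less than that of the whole space is, up to a null set, a union of countably many
sets of measure less than `ε`. -/
theorem exists_countable_cover (hm : IsChainMeasure lam 𝔐 m)
    (h𝔐 : IsMeasurableStructure lam 𝔐) (hlam : ℵ₀ ≤ lam)
    (hcov : ∀ ε : S, 0 < ε → ∃ F : Set (Set X), #F ≤ lam ∧ F ⊆ 𝔐 ∧ (∀ B ∈ F, m B < ε) ∧
      ⋃₀ F = Set.univ)
    {E : Set X} (hE : E ∈ 𝔐) (hEX : m E < m Set.univ) {e : ℕ → S} (he : ∀ n, 0 < e n)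
    (hcoin : ∀ ε : S, 0 < ε → ∃ n, e n ≤ ε) {ε : S} (hε : 0 < ε) :
    ∃ D : ℕ → Set X, (∀ n, D n ∈ 𝔐) ∧ (∀ n, m (D n) < ε) ∧ m (E \ ⋃ n, D n) = 0 := by
  obtain ⟨F, hF, hF𝔐, hFε, hFU⟩ := hcov ε hε
  obtain ⟨γ, hγ, G, hG, hU⟩ := exists_initialUnion_eq_sUnion F hF
  have hG𝔐 : ∀ i, G i ∈ 𝔐 := fun i => by
    rcases hG i with h | h
    · exact hF𝔐 h
    · exact h ▸ h𝔐.empty_mem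
  have hGε : ∀ i, m (G i) < ε := fun i => by
    rcases hG i with h | h
    · exact hFε _ h
    · rwa [h, hm.empty]
  set K : Ordinal.{u} → Set X := fun i => (G i \ initialUnion G i) ∩ E with hK
  have hK𝔐 : ∀ i < γ, K i ∈ 𝔐 := fun i hi => h𝔐.inter_mem hlam
    (h𝔐.diff_mem hlam (hG𝔐 i) (h𝔐.initialUnion_mem hG𝔐 (hi.trans hγ))) hE
  have hKε : ∀ i < γ, m (K i) < ε := fun i hi =>
    (hm.mono _ (hK𝔐 i hi) _ (hG𝔐 i)
      (Set.inter_subset_left.trans Set.sdiff_subset)).trans_lt (hGε i)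
  have hKd : ∀ i j, i ≠ j → Disjoint (K i) (K j) := fun i j hij =>
    (disjoint_diff_initialUnion G hij).mono Set.inter_subset_left Set.inter_subset_left
  have hKE : initialUnion K γ = E := by
    rw [hK, initialUnion_inter, initialUnion_diff_initialUnion, hU, hFU, Set.univ_inter]
  let T : Set Ordinal.{u} := {i | i < γ ∧ 0 < m (K i)}
  -- Each positive measure exceeds or equals some `e n`, and for each `n` only finitely many
  -- disjoint pieces do so.
  have hT : T.Countable := by
    have hsub : T ⊆ ⋃ n, {i | i < γ ∧ e n ≤ m (K i)} := by
      rintro i ⟨hi, hpos⟩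
      obtain ⟨n, hn⟩ := hcoin _ hpos
      exact Set.mem_iUnion.2 ⟨n, hi, hn⟩
    refine (Set.countable_iUnion fun n => Set.Finite.countable ?_).mono hsub
    by_contra hinf
    let f := Set.Infinite.natEmbedding _ hinf
    obtain ⟨k, hk⟩ := hm.not_exists_disjoint_ge h𝔐 hlam hcov (A := fun k => K (f k))
      (fun k => hK𝔐 _ (f k).2.1)
      (fun i j hij => hKd _ _ fun h => hij (f.injective (Subtype.ext h)))
      hE (fun k => Set.inter_subset_right) hEX (he n)
    exact absurd (f k).2.2 (not_le.2 hk)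
  have hnull : ∀ D : Set X, D ∈ 𝔐 → (∀ i ∈ T, K i ⊆ D) → m (E \ D) = 0 := by
    intro D hD hTD
    classical
    refine le_antisymm ?_ (hm.zero_le _)
    -- What `D` misses lies in the null pieces, whose union is null because `0` is idempotent.
    let N : Ordinal.{u} → Set X := fun i => if i < γ ∧ m (K i) = 0 then K i else ∅
    have hN𝔐 : ∀ i, N i ∈ 𝔐 := fun i => by
      by_cases h : i < γ ∧ m (K i) = 0
      · simpa [N, h] using hK𝔐 i h.1
      · simpa [N, h] using h𝔐.empty_mem
    have hN0 : ∀ i, m (N i) ≤ 0 := fun i => by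
      by_cases h : i < γ ∧ m (K i) = 0
      · simp [N, h]
      · simp [N, h, hm.empty]
    refine (hm.mono _ (h𝔐.diff_mem hlam hE hD) _ (h𝔐.initialUnion_mem hN𝔐 hγ) ?_).trans
      (hm.initialUnion_le h𝔐 hlam (add_zero (0 : S)).le hN𝔐 hN0 hγ)
    rintro x ⟨hxE, hxD⟩
    rw [← hKE, mem_initialUnion] at hxE
    obtain ⟨i, hi, hx⟩ := hxE
    have h0 : m (K i) = 0 := by
      by_contra h
      exact hxD (hTD i ⟨hi, lt_of_le_of_ne (hm.zero_le _) (Ne.symm h)⟩ hx)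
    exact (mem_initialUnion N).2 ⟨i, hi, by simpa [N, hi, h0] using hx⟩
  rcases T.eq_empty_or_nonempty with h | h
  · refine ⟨fun _ => ∅, fun _ => h𝔐.empty_mem, fun _ => by rwa [hm.empty], hnull _ ?_ ?_⟩
    · simpa using h𝔐.empty_mem
    · simp [h]
  · obtain ⟨f, hf⟩ := hT.exists_eq_range h
    have hfT : ∀ n, f n ∈ T := fun n => hf ▸ Set.mem_range_self n
    refine ⟨fun n => K (f n), fun n => hK𝔐 _ (hfT n).1, fun n => hKε _ (hfT n).1, hnull _ ?_ ?_⟩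
    · exact h𝔐.iUnion_nat_mem hlam _ fun n => hK𝔐 _ (hfT n).1
    · intro i hi
      rw [hf] at hi
      obtain ⟨n, rfl⟩ := hi
      exact Set.subset_iUnion (fun n => K (f n)) n

/-- A point outside all exceptional null sets follows a branch f : ℕ → ℕ through the covers. There
are at most `lam` branches, and each gives an intersection smaller than every `e n`, hence null. -/
theorem eq_zero_of_countable_cover (hm : IsChainMeasure lam 𝔐 m)
    (h𝔐 : IsMeasurableStructure lam 𝔐) (hlam : Cardinal.continuum ≤ lam)
    {E : Set X} (hE : E ∈ 𝔐) {e : ℕ → S} (hcoin : ∀ ε : S, 0 < ε → ∃ n, e n ≤ ε)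
    (hcover : ∀ n, ∃ D : ℕ → Set X, (∀ k, D k ∈ 𝔐) ∧ (∀ k, m (D k) < e n) ∧
      m (E \ ⋃ k, D k) = 0) : m E = 0 := by
  have hlam' : ℵ₀ ≤ lam := aleph0_le_continuum.trans hlam
  choose D hD𝔐 hDe hD0 using hcover
  refine le_antisymm ?_ (hm.zero_le _)
  have hdiff : ∀ n, E \ ⋃ k, D n k ∈ 𝔐 := fun n =>
    h𝔐.diff_mem hlam' hE (h𝔐.iUnion_nat_mem hlam' _ (hD𝔐 n))
  have hint : ∀ f : ℕ → ℕ, ⋂ n, D n (f n) ∈ 𝔐 := fun f =>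
    h𝔐.iInter_nat_mem hlam' _ fun n => hD𝔐 n _
  have hcard : Cardinal.lift.{u} #(ℕ → ℕ) ≤ Cardinal.lift.{0} lam := by simpa using hlam
  have h1 : m (⋃ n, E \ ⋃ k, D n k) ≤ 0 :=
    hm.iUnion_le h𝔐 hlam' (add_zero (0 : S)).le _ (by simpa using hlam') hdiff
      fun n => (hD0 n).le
  have h2 : m (⋃ f : ℕ → ℕ, ⋂ n, D n (f n)) ≤ 0 := by
    refine hm.iUnion_le h𝔐 hlam' (add_zero (0 : S)).le _ hcard hint fun f => ?_
    by_contra! h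
    obtain ⟨n, hn⟩ := hcoin _ h
    exact absurd (hm.mono _ (hint f) _ (hD𝔐 n _) (Set.iInter_subset _ n))
      (not_le.2 ((hDe n _).trans_le hn))
  have hmem1 := h𝔐.iUnion_nat_mem hlam' _ hdiff
  have hmem2 := h𝔐.iUnion_mem _ hint hcard
  refine (hm.mono _ hE _ (h𝔐.union_mem hlam' hmem1 hmem2) ?_).trans
    ((hm.union_le h𝔐 hlam' hmem1 hmem2).trans ((add_le_add h1 h2).trans (add_zero 0).le))
  intro x hx
  by_cases h : ∀ n, ∃ k, x ∈ D n k
  · choose f hf using h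
    exact Or.inr (Set.mem_iUnion.2 ⟨f, Set.mem_iInter.2 hf⟩)
  · push Not at h
    obtain ⟨n, hn⟩ := h
    exact Or.inl (Set.mem_iUnion.2 ⟨n, hx, by simpa using hn⟩)

end IsChainMeasure

/-! ### Point-regularity and the contradiction -/

theorem exists_isTopologicalBasis_mk_le {X : Type u} [TopologicalSpace X] {lam : Cardinal.{u}}
    (hX : topWeight X ≤ lam) :
    ∃ B : Set (Set X), TopologicalSpace.IsTopologicalBasis B ∧ #B ≤ lam := by
  obtain ⟨B, hB, hcard⟩ := csInf_mem (s := {c : Cardinal.{u} | ∃ B : Set (Set X),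
    TopologicalSpace.IsTopologicalBasis B ∧ #B = c})
    ⟨_, _, TopologicalSpace.isTopologicalBasis_opens, rfl⟩
  exact ⟨B, hB, hcard.trans_le hX⟩

theorem continuum_le_of_powerlt_two_le {lam : Cardinal.{u}} (hpow : Cardinal.powerlt 2 lam ≤ lam)
    (hlam : ℵ₀ < lam) : Cardinal.continuum ≤ lam := by
  rw [← two_power_aleph0]
  exact (le_powerlt 2 hlam).trans hpow

/-- Point-regularity for the basic neighbourhoods of a null point. -/
theorem IsLamMeasure.exists_basic_lt {lam : Cardinal.{u}} {X : Type u} [TopologicalSpace X]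
    {𝔐 : Set (Set X)} {S : Type v} [AddMonoid S] [LinearOrder S] {Sm : OrdSeq.{u, v} S →. S}
    {μ : Set X →. S} {m : Set X → S} (h𝔐 : IsMeasurableStructure lam 𝔐)
    (hμ : IsLamMeasure lam 𝔐 Sm μ) (hm : ∀ A ∈ 𝔐, m A ∈ μ A) {B : Set (Set X)}
    (hB : TopologicalSpace.IsTopologicalBasis B) (hBlam : #B ≤ lam) {x : X} (hx : {x} ∈ 𝔐)
    (hx0 : (0 : S) ∈ μ {x}) {V : Set X} (hV : IsOpen V) (hxV : x ∈ V) {ε : S} (hε : 0 < ε) :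
    ∃ U ∈ B, x ∈ U ∧ U ⊆ V ∧ m U < ε := by
  obtain ⟨γ, hγ, A, hA⟩ := exists_range_eq_of_mk_le {U ∈ B | x ∈ U ∧ U ⊆ V}
    ((mk_le_mk_of_subset (Set.sep_subset _ _)).trans hBlam)
  have hAmem : ∀ i, A i ∈ B ∧ x ∈ A i ∧ A i ⊆ V := fun i => by
    have : A i ∈ Set.range A := Set.mem_range_self i
    rwa [hA] at this
  have hbasis : IsOpenLocalBasis x A := by
    refine ⟨fun i => hB.isOpen (hAmem i).1, fun i => (hAmem i).2.1, fun W hW hxW => ?_⟩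
    obtain ⟨U, hU, hxU, hUW⟩ := hB.exists_subset_of_mem_open (u := V ∩ W) ⟨hxV, hxW⟩ (hV.inter hW)
    have : U ∈ Set.range A := hA ▸ ⟨hU, hxU, hUW.trans Set.inter_subset_left⟩
    obtain ⟨i, rfl⟩ := this
    exact ⟨i, hUW.trans Set.inter_subset_right⟩
  have hglb := hμ.point_regular x hx γ hγ A hbasis 0 hx0
  by_contra! h
  refine absurd (hglb.2 (?_ : ε ∈ lowerBounds _)) (not_le.2 hε)
  rintro a ⟨i, ha⟩
  obtain ⟨h1, h2, h3⟩ := hAmem i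
  rw [Part.mem_unique ha (hm _ (h𝔐.open_mem _ (hB.isOpen h1)))]
  exact h _ h1 h2 h3

theorem mainTheorem2 (lam : Cardinal.{u})
    (hpow : Cardinal.powerlt 2 lam = lam) (hlam : Cardinal.aleph0 < lam)
    (X : Type u) [TopologicalSpace X] [T0Space X] (hX : topWeight X ≤ lam)
    (S : Type v) [AddMonoid S] [LinearOrder S] [AddLeftMono S] [AddRightMono S]
    (hS : IsPositivelyOrdered S) (Sm : OrdSeq.{u, v} S →. S) (hSm : IsInfinitarySum Sm) :
    ¬ ∃ (𝔐 : Set (Set X)) (μ : Set X →. S),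
      IsMeasurableStructure lam 𝔐 ∧ IsLamMeasure lam 𝔐 Sm μ ∧ IsContinuousMeasure 𝔐 μ := by
  rintro ⟨𝔐, μ, h𝔐, hμ, hcont⟩
  classical
  obtain ⟨m, hmμ⟩ : ∃ m : Set X → S, ∀ A ∈ 𝔐, m A ∈ μ A :=
    ⟨fun A => if h : (μ A).Dom then (μ A).get h else 0, fun A hA => by
      have h : (μ A).Dom := hμ.subset_dom hA
      simp only [h, dite_true]
      exact Part.get_mem h⟩
  have hlam' := hlam.le
  have hm := hμ.isChainMeasure hlam' h𝔐 hS hSm hmμ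
  obtain ⟨B, hB, hBlam⟩ := exists_isTopologicalBasis_mk_le hX
  have hsmall : ∀ (x : X) (V : Set X), IsOpen V → x ∈ V → ∀ ε : S, 0 < ε →
      ∃ U ∈ B, x ∈ U ∧ U ⊆ V ∧ m U < ε := fun x V hV hxV ε hε =>
    IsLamMeasure.exists_basic_lt h𝔐 hμ hmμ hB hBlam (hcont x).1 (hcont x).2 hV hxV hε
  have hpos : 0 < m Set.univ := by
    obtain ⟨a, ha, ha0⟩ := hμ.univ_pos
    rwa [Part.mem_unique (hmμ _ h𝔐.univ_mem) ha]
  have hcov : ∀ ε : S, 0 < ε → ∃ F : Set (Set X), #F ≤ lam ∧ F ⊆ 𝔐 ∧ (∀ B ∈ F, m B < ε) ∧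
      ⋃₀ F = Set.univ := by
    intro ε hε
    refine ⟨{U ∈ B | m U < ε}, (mk_le_mk_of_subset (Set.sep_subset _ _)).trans hBlam,
      fun U hU => h𝔐.open_mem _ (hB.isOpen hU.1), fun U hU => hU.2,
      Set.eq_univ_of_forall fun x => ?_⟩
    obtain ⟨U, hU, hxU, -, hUε⟩ := hsmall x Set.univ isOpen_univ (Set.mem_univ x) ε hε
    exact ⟨U, ⟨hU, hUε⟩, hxU⟩
  -- Otherwise the null basic sets, at most `lam` many, would cover the space.
  obtain ⟨p, hp⟩ : ∃ p : X, ∀ U : Set X, IsOpen U → p ∈ U → 0 < m U := by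
    by_contra! h
    have hle := hm.sUnion_le h𝔐 hlam' (add_zero (0 : S)).le (F := {U ∈ B | m U ≤ 0})
      ((mk_le_mk_of_subset (Set.sep_subset _ _)).trans hBlam)
      (fun U hU => h𝔐.open_mem _ (hB.isOpen hU.1)) (fun U hU => hU.2)
    have huniv : ⋃₀ {U ∈ B | m U ≤ 0} = Set.univ := Set.eq_univ_of_forall fun x => by
      obtain ⟨V, hV, hxV, hV0⟩ := h x
      obtain ⟨U, hU, hxU, hUV⟩ := hB.exists_subset_of_mem_open hxV hV
      exact ⟨U, ⟨hU, (hm.mono _ (h𝔐.open_mem _ (hB.isOpen hU)) _ (h𝔐.open_mem _ hV) hUV).trans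
        hV0⟩, hxU⟩
    rw [huniv] at hle
    exact absurd hle (not_le.2 hpos)
  let N := {U : Set X // IsOpen U ∧ p ∈ U}
  have hstep : ∀ V : N, ∃ U : N, U.1 ⊆ V.1 ∧ m U.1 < m V.1 := fun ⟨V, hV, hpV⟩ => by
    obtain ⟨U, hU, hpU, hUV, hlt⟩ := hsmall p V hV hpV _ (hp V hV hpV)
    exact ⟨⟨U, hB.isOpen hU, hpU⟩, hUV, hlt⟩
  choose next hnext_sub hnext_lt using hstep
  -- The shift by one makes `W 0` already of smaller measure than the space, as
  -- `not_exists_disjoint_ge` requires.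
  let W : ℕ → N := fun n => next^[n + 1] ⟨Set.univ, isOpen_univ, Set.mem_univ p⟩
  have hWsucc : ∀ n, W (n + 1) = next (W n) := fun n => Function.iterate_succ_apply' _ _ _
  have hW𝔐 : ∀ n, (W n).1 ∈ 𝔐 := fun n => h𝔐.open_mem _ (W n).2.1
  have hWanti : Antitone fun n => (W n).1 := antitone_nat_of_succ_le fun n => by
    rw [hWsucc]; exact hnext_sub _
  have hWlt : ∀ n, m (W (n + 1)).1 < m (W n).1 := fun n => by rw [hWsucc]; exact hnext_lt _
  have hW0 : m (W 0).1 < m Set.univ := hnext_lt _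
  let R : ℕ → Set X := fun n => (W n).1 \ (W (n + 1)).1
  have hR𝔐 : ∀ n, R n ∈ 𝔐 := fun n => h𝔐.diff_mem hlam' (hW𝔐 _) (hW𝔐 _)
  -- A null ring would give `W n` and `W (n + 1)` equal measure.
  have hRpos : ∀ n, 0 < m (R n) := fun n => by
    refine lt_of_le_of_ne (hS.zero_le _) fun h0 => (hWlt n).ne ?_
    have := hm.union _ (hR𝔐 n) _ (hW𝔐 (n + 1)) Set.disjoint_sdiff_left
    rw [← h0, zero_add, Set.sdiff_union_of_subset (hWanti n.le_succ)] at this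
    exact this.symm
  have hRdisj : Pairwise fun i j => Disjoint (R i) (R j) := by
    have hlt : ∀ i j, i < j → Disjoint (R i) (R j) := fun i j hij =>
      Set.disjoint_sdiff_left.mono_right (Set.sdiff_subset.trans (hWanti hij))
    intro i j hij
    rcases lt_or_gt_of_ne hij with h | h
    · exact hlt i j h
    · exact (hlt j i h).symm
  have hcoin : ∀ ε : S, 0 < ε → ∃ n, m (R n) ≤ ε := fun ε hε => by
    obtain ⟨n, hn⟩ := hm.not_exists_disjoint_ge h𝔐 hlam' hcov hR𝔐 hRdisj (hW𝔐 0)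
      (fun n => Set.sdiff_subset.trans (hWanti n.zero_le)) hW0 hε
    exact ⟨n, hn.le⟩
  have hzero := hm.eq_zero_of_countable_cover h𝔐 (continuum_le_of_powerlt_two_le hpow.le hlam)
    (hW𝔐 0) hcoin fun n => hm.exists_countable_cover h𝔐 hlam' hcov (hW𝔐 0) hW0 hRpos hcoin
      (hRpos n)
  exact (hp _ (W 0).2.1 (W 0).2.2).ne' hzero
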